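/- For $\mathrm{Re}(q)>0$ let $\zeta(s,q)$ denote the Hurwitz zeta function, i.e. the analytic continuation to $s\in\mathbb{C}\setminus\{1\}$ of $\sum_{n=0}^\infty (q+n)^{-s}$, $\mathrm{Re}(s)>1$ (principal powers). For $\alpha\in\mathbb{C}$ let $\mathrm{Li}_\alpha(z)$ denote the polylogarithm, i.e. the analytic continuation to $z\in\mathbb{C}\setminus[1,\infty)$ of $\sum_{n=1}^\infty z^n n^{-\alpha}$, $|z|<1$. These continuations exist, and the following estimates hold. (i) Let $\mathrm{Re}(q)>0$ and $\theta_1,\theta_2>0$. Then there is $\varepsilon>0$ such that $$\zeta(s,q)=O\Big(\exp\big((\tfrac12\pi-\varepsilon)|\mathrm{Im}(s)|\big)\Big)$$ as $|\mathrm{Im}(s)|\to\infty$, uniformly with respect to $-\theta_1\le\mathrm{Re}(s)\le\theta_2$. (ii) Let $z\in\mathbb{C}\setminus[1,\infty)$ and $\theta_1,\theta_2>0$. Then there is $\varepsilon>0$ such that $$\mathrm{Li}_\alpha(z)=O\Big(\exp\big((\tfrac12\pi-\varepsilon)|\mathrm{Im}(\alpha)|\big)\Big)$$ uniformly for all $\alpha$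 with $-\theta_1\le\mathrm{Re}(\alpha)\le\theta_2$. -/

import Mathlib

/-- `F` is the Hurwitz zeta function `s ↦ ζ(s, q)`: it is holomorphic on `ℂ ∖ {1}` and
`F s = ∑_{n ≥ 0} 1 / (q + n) ^ s` for `Re s > 1`. (Principal powers; used for `Re q > 0`. The value
at `s = 1` is irrelevant.) -/
structure IsHurwitzZeta (q : ℂ) (F : ℂ → ℂ) : Prop where
  differentiableOn : DifferentiableOn ℂ F {1}ᶜ
  hasSum : ∀ s : ℂ, 1 < s.re → HasSum (fun n : ℕ => 1 / (q + (n : ℂ)) ^ s) (F s)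

/-- The slit plane `ℂ ∖ [1, ∞)`. -/
def polylogDomain : Set ℂ := ((fun x : ℝ => (x : ℂ)) '' Set.Ici 1)ᶜ

/-- `F` is the polylogarithm `z ↦ Li_α(z)`: it is holomorphic on `ℂ ∖ [1, ∞)` and
`F z = ∑_{n ≥ 1} z ^ n / n ^ α` for `|z| < 1`. (The values on `[1, ∞)` are irrelevant.) -/
structure IsPolylog (α : ℂ) (F : ℂ → ℂ) : Prop where
  differentiableOn : DifferentiableOn ℂ F polylogDomain
  hasSum : ∀ z : ℂ, ‖z‖ < 1 →
    HasSum (fun n : ℕ => z ^ (n + 1) / ((n + 1 : ℕ) : ℂ) ^ α) (F z)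

/-- The analytic continuation of the Hurwitz zeta series is unique. -/
theorem IsHurwitzZeta.eqOn {q : ℂ} {F G : ℂ → ℂ} (hF : IsHurwitzZeta q F)
    (hG : IsHurwitzZeta q G) : Set.EqOn F G {1}ᶜ := by
  have ho : IsOpen ({1}ᶜ : Set ℂ) := isOpen_compl_singleton
  have hc : IsPreconnected ({1}ᶜ : Set ℂ) :=
    (isConnected_compl_singleton_of_one_lt_rank (by simp) (1 : ℂ)).isPreconnected
  refine (hF.differentiableOn.analyticOnNhd ho).eqOn_of_preconnected_of_eventuallyEq
    (hG.differentiableOn.analyticOnNhd ho) hc (z₀ := 2) (by simp) ?_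
  have hopen : IsOpen {s : ℂ | 1 < s.re} := isOpen_lt continuous_const Complex.continuous_re
  filter_upwards [hopen.mem_nhds (show (2 : ℂ) ∈ {s : ℂ | 1 < s.re} by simp)] with s hs
  exact (hF.hasSum s hs).unique (hG.hasSum s hs)

/-- The analytic continuation of the polylogarithm series to `ℂ ∖ [1, ∞)` is unique. -/
theorem IsPolylog.eqOn {α : ℂ} {F G : ℂ → ℂ} (hF : IsPolylog α F) (hG : IsPolylog α G) :
    Set.EqOn F G polylogDomain := by
  have ho : IsOpen polylogDomain :=
    (Complex.isometry_ofReal.isClosedEmbedding.isClosedMap _ isClosed_Ici).isOpen_compl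
  have h0 : (0 : ℂ) ∈ polylogDomain := by
    rintro ⟨x, hx, h⟩
    have hx0 : x = 0 := by simpa using h
    rw [Set.mem_Ici, hx0] at hx
    linarith
  have hs : StarConvex ℝ (0 : ℂ) polylogDomain := by
    rw [starConvex_iff_segment_subset]
    intro z hz w hw
    rw [segment_eq_image] at hw
    obtain ⟨t, ⟨ht0, ht1⟩, rfl⟩ := hw
    rintro ⟨x, hx, h⟩
    have hx1 : (1 : ℝ) ≤ x := hx
    have h' : (x : ℂ) = (t : ℂ) * z := by simpa using h
    have ht : 0 < t := by
      rcases ht0.lt_or_eq with ht | ht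
      · exact ht
      · rw [← ht] at h'
        have hx0 : x = 0 := by simpa using h'
        linarith
    refine hz ⟨x / t, ?_, ?_⟩
    · rw [Set.mem_Ici, le_div_iff₀ ht]
      linarith
    · have htc : (t : ℂ) ≠ 0 := by exact_mod_cast ht.ne'
      simp only [Complex.ofReal_div]
      rw [h']
      field_simp
  refine (hF.differentiableOn.analyticOnNhd ho).eqOn_of_preconnected_of_eventuallyEq
    (hG.differentiableOn.analyticOnNhd ho) (hs.isPathConnected h0).isConnected.isPreconnected h0 ?_
  filter_upwards [Metric.ball_mem_nhds (0 : ℂ) one_pos] with z hz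
  have hz' : ‖z‖ < 1 := by simpa using hz
  exact (hF.hasSum z hz').unique (hG.hasSum z hz')

open Classical in
/-- The Hurwitz zeta function `ζ(s, q)` with a complex parameter `q`, `Re q > 0`: the analytic
continuation of its series in `s`. -/
noncomputable def complexHurwitzZeta (q s : ℂ) : ℂ :=
  if h : ∃ F : ℂ → ℂ, IsHurwitzZeta q F then h.choose s else 0

open Classical in
/-- The polylogarithm `Li_α(z)`: the analytic continuation of its series in `z` to
`ℂ ∖ [1, ∞)`. -/
noncomputable def polylog (α z : ℂ) : ℂ :=
  if h : ∃ F : ℂ → ℂ, IsPolylog α F then h.choose z else 0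

/-! Both estimates come from keeping arguments strictly inside `(-π/2, π/2)`.

Polylogarithm: for `Re α > 0`, `Li_α(z) = ρ^α / Γ(α) · ∫ t^(α-1) z e^(-ρt) / (1 - z e^(-ρt)) dt` for
`ρ = e^(±iδ)` with `δ` small, since the denominator stays away from zero near the segment `[0, z]`.
With the sign of `Im α`, `|ρ^α| = e^(-δ|Im α|)`. The factor `1/Γ(α)` costs `e^((π/2+η)|Im α|)` for
any small `η > 0`, by reflection and the decay of `Γ`, itself proved on a tilted ray. Taking `η =
δ/2` leaves the rate `π/2 - δ/2` (`exists_norm_polylog_le_of_one_le_re`). Smaller `Re α` is reached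
through `Li_(α-1) = z · Li_α'` and Cauchy's estimate (`exists_norm_polylog_le_locally`).

Hurwitz zeta: `|arg (q + x)| ≤ |arg q| < π/2` for `x ≥ 0`, so every term of the series is at most
`|q + n|^(-Re s) e^(|arg q||Im s|)`. Summing a Taylor formula gives `(s-1)ζ(s,q) = q^(1-s) + (s-1)
∫₀¹ (1-u) s ζ(s+1, q+u) du`, which continues the function one unit to the left at a time
(`hurwitzStep`). Each step costs only a polynomial factor, absorbed by any rate `ψ > |arg q|`
(`exists_norm_hurwitzStep_le`). -/

open Complex Set Filter Topology MeasureTheory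

/-! ### Parameter integrals -/

/-- Holomorphic dependence of an integral on a parameter, under a locally uniform domination. -/
theorem differentiableOn_integral_of_dominated {X : Type*} [MeasurableSpace X] {μ : Measure X}
    {U : Set ℂ} (hU : IsOpen U) {f : ℂ → X → ℂ} {g : X → ℝ}
    (hmeas : ∀ z ∈ U, AEStronglyMeasurable (f z) μ)
    (hdiff : ∀ᵐ x ∂μ, DifferentiableOn ℂ (fun z => f z x) U)
    (hbound : ∀ᵐ x ∂μ, ∀ z ∈ U, ‖f z x‖ ≤ g x) (hg : Integrable g μ) :
    DifferentiableOn ℂ (fun z => ∫ x, f z x ∂μ) U := by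
  intro z₀ hz₀
  obtain ⟨r, hr, hrU⟩ := Metric.isOpen_iff.1 hU z₀ hz₀
  have hmem : ∀ z ∈ Metric.ball z₀ (r / 2), Metric.closedBall z (r / 4) ⊆ U := by
    intro z hz w hw
    apply hrU
    rw [Metric.mem_ball] at hz ⊢
    rw [Metric.mem_closedBall] at hw
    linarith [dist_triangle w z z₀]
  have hsub : ∀ z ∈ Metric.ball z₀ (r / 2), z ∈ U := fun z hz =>
    hmem z hz (Metric.mem_closedBall_self (by linarith))
  have hnhds : Metric.ball z₀ (r / 2) ∈ 𝓝 z₀ := Metric.ball_mem_nhds _ (by linarith)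
  have hd : ∀ᵐ x ∂μ, ∀ z ∈ Metric.ball z₀ (r / 2),
      HasDerivAt (fun z => f z x) (deriv (fun z => f z x) z) z := by
    filter_upwards [hdiff] with x hx z hz
    exact (hx.differentiableAt (hU.mem_nhds (hsub z hz))).hasDerivAt
  -- The derivative is an almost everywhere limit of measurable difference quotients along `w n →
  -- z₀`.
  have hm' : AEStronglyMeasurable (fun x => deriv (fun z => f z x) z₀) μ := by
    let w : ℕ → ℂ := fun n => z₀ + ((r / 4 / (n + 1) : ℝ) : ℂ)
    have hw0 : ∀ n : ℕ, 0 < r / 4 / ((n : ℝ) + 1) := fun n => by positivity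
    have hwU : ∀ n, w n ∈ U := by
      intro n
      refine hmem z₀ (Metric.mem_ball_self (by linarith)) ?_
      rw [Metric.mem_closedBall, dist_eq_norm]
      simp only [w, add_sub_cancel_left, norm_real, Real.norm_eq_abs, abs_of_pos (hw0 n)]
      exact div_le_self (by linarith) (by linarith [Nat.cast_nonneg (α := ℝ) n])
    have hwt : Tendsto w atTop (𝓝[≠] z₀) := by
      refine tendsto_nhdsWithin_iff.2 ⟨?_, Eventually.of_forall fun n => ?_⟩
      · have h1 : Tendsto (fun n : ℕ => r / 4 / ((n : ℝ) + 1)) atTop (𝓝 0) :=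
          tendsto_const_nhds.div_atTop (tendsto_atTop_add_const_right _ _
            tendsto_natCast_atTop_atTop)
        have h2 := (continuous_ofReal.tendsto 0).comp h1
        simpa [w] using h2.const_add z₀
      · simp only [w, mem_compl_iff, mem_singleton_iff, add_eq_left, ofReal_eq_zero]
        exact (hw0 n).ne'
    refine aestronglyMeasurable_of_tendsto_ae atTop
      (f := fun n x => (w n - z₀)⁻¹ * (f (w n) x - f z₀ x)) (fun n => ?_) ?_
    · exact ((hmeas _ (hwU n)).sub (hmeas _ hz₀)).const_mul _
    · filter_upwards [hd] with x hx
      have := (hasDerivAt_iff_tendsto_slope.1 (hx z₀ (Metric.mem_ball_self (by linarith)))).comp hwt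
      simpa [slope, Function.comp_def] using this
  have key := hasDerivAt_integral_of_dominated_loc_of_deriv_le (μ := μ) (F := f) (x₀ := z₀)
    (F' := fun z x => deriv (fun z => f z x) z) (bound := fun x => g x / (r / 4)) hnhds
    (by filter_upwards [hnhds] with z hz using hmeas z (hsub z hz))
    (hg.mono' (hmeas z₀ hz₀) (by filter_upwards [hbound] with x hx using hx z₀ hz₀)) hm' ?_
    (hg.div_const _) hd
  · exact key.2.differentiableAt.differentiableWithinAt
  -- Cauchy's estimate on circles of radius `r / 4` turns the bound on `f` into one on its
  -- derivative.
  · filter_upwards [hbound, hdiff] with x hx hxd z hz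
    refine norm_deriv_le_of_forall_mem_sphere_norm_le (by linarith) ?_ fun w hw =>
      hx w (hmem z hz (Metric.sphere_subset_closedBall hw))
    refine (hxd.mono ?_).diffContOnCl
    rw [closure_ball _ (by linarith)]
    exact hmem z hz

/-! ### Gamma integrals and the Gamma function on vertical strips -/

theorem integrableOn_cpow_mul_exp_neg {a ρ : ℂ} (ha : 0 < a.re) (hρ : 0 < ρ.re) :
    IntegrableOn (fun t : ℝ => (t : ℂ) ^ (a - 1) * exp (-(ρ * t))) (Ioi 0) := by
  have h := integrableOn_rpow_mul_exp_neg_mul_rpow (p := 1) (s := a.re - 1) (b := ρ.re)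
    (by linarith) one_pos hρ
  refine Integrable.mono' h ?_ ?_
  · refine (ContinuousOn.mul (fun t ht => ?_) (by fun_prop)).aestronglyMeasurable measurableSet_Ioi
    exact (continuousAt_ofReal_cpow_const _ _ (Or.inr (ne_of_gt ht))).continuousWithinAt
  · filter_upwards [ae_restrict_mem measurableSet_Ioi] with t ht
    rw [norm_mul, norm_cpow_eq_rpow_re_of_pos ht, norm_exp]
    simp

theorem norm_integral_cpow_mul_le {a : ℂ} {κ c : ℝ} (ha : 0 < a.re) (hκ : 0 < κ) {φ : ℝ → ℂ}
    (hφ : ∀ t, 0 < t → ‖φ t‖ ≤ c * Real.exp (-(κ * t))) :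
    ‖∫ t : ℝ in Ioi 0, (t : ℂ) ^ (a - 1) * φ t‖ ≤ c * ((1 / κ) ^ a.re * Real.Gamma a.re) := by
  rw [← Real.integral_rpow_mul_exp_neg_mul_Ioi ha hκ, ← integral_const_mul]
  refine norm_integral_le_of_norm_le ?_ ?_
  · have h := integrableOn_rpow_mul_exp_neg_mul_rpow (p := 1) (s := a.re - 1) (b := κ)
      (by linarith) one_pos hκ
    refine Integrable.const_mul ?_ _
    simpa [IntegrableOn] using h
  · filter_upwards [ae_restrict_mem measurableSet_Ioi] with t ht
    rw [norm_mul, norm_cpow_eq_rpow_re_of_pos ht, sub_re, one_re]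
    calc _ ≤ t ^ (a.re - 1) * (c * Real.exp (-(κ * t))) := by
          gcongr
          · exact Real.rpow_nonneg (le_of_lt ht) _
          · exact hφ t ht
      _ = _ := by ring

theorem exists_one_div_rpow_mul_Gamma_le {κ : ℝ} (hκ : 0 < κ) {a b : ℝ} (ha : 0 < a) :
    ∃ C : ℝ, 0 < C ∧ ∀ σ : ℝ, a ≤ σ → σ ≤ b → (1 / κ) ^ σ * Real.Gamma σ ≤ C := by
  obtain ⟨C, hC⟩ := (isCompact_Icc (a := a) (b := b)).exists_bound_of_continuousOn
    (f := fun σ : ℝ => (1 / κ) ^ σ * Real.Gamma σ) (by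
      intro σ hσ
      have hσ0 : 0 < σ := ha.trans_le hσ.1
      refine ContinuousAt.continuousWithinAt (ContinuousAt.mul ?_ ?_)
      · exact Real.continuousAt_const_rpow (by positivity)
      · exact (Real.differentiableAt_Gamma fun m hm => by
          linarith [Nat.cast_nonneg (α := ℝ) m]).continuousAt)
  refine ⟨|C| + 1, by positivity, fun σ h1 h2 => ?_⟩
  have := (le_abs_self _).trans (hC σ ⟨h1, h2⟩)
  linarith [le_abs_self C]

/-- The Gamma integral along a rotated ray. -/
theorem integral_cpow_mul_exp_neg_mul_of_re_pos {a ρ : ℂ} (ha : 0 < a.re) (hρ : 0 < ρ.re) :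
    ∫ t : ℝ in Ioi 0, (t : ℂ) ^ (a - 1) * exp (-(ρ * t)) = ρ ^ (-a) * Gamma a := by
  have hopen : IsOpen {ρ : ℂ | 0 < ρ.re} := isOpen_lt continuous_const continuous_re
  have hL : DifferentiableOn ℂ
      (fun ρ : ℂ => ∫ t : ℝ in Ioi 0, (t : ℂ) ^ (a - 1) * exp (-(ρ * t))) {ρ : ℂ | 0 < ρ.re} := by
    intro ρ₀ (hρ₀ : 0 < ρ₀.re)
    have ho : IsOpen {ρ : ℂ | ρ₀.re / 2 < ρ.re} := isOpen_lt continuous_const continuous_re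
    have := differentiableOn_integral_of_dominated (μ := volume.restrict (Ioi (0 : ℝ))) ho
      (f := fun ρ t => (t : ℂ) ^ (a - 1) * exp (-(ρ * t)))
      (g := fun t => t ^ (a.re - 1) * Real.exp (-(ρ₀.re / 2) * t)) ?_ ?_ ?_ ?_
    · exact (this.differentiableAt (ho.mem_nhds (show ρ₀.re / 2 < ρ₀.re by
        linarith))).differentiableWithinAt
    · intro ρ (hρ : ρ₀.re / 2 < ρ.re)
      exact (integrableOn_cpow_mul_exp_neg ha (by linarith)).aestronglyMeasurable
    · exact Eventually.of_forall fun t => by fun_prop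
    · filter_upwards [ae_restrict_mem measurableSet_Ioi] with t ht ρ (hρ : ρ₀.re / 2 < ρ.re)
      have ht : 0 < t := ht
      rw [norm_mul, norm_cpow_eq_rpow_re_of_pos ht, norm_exp]
      simp only [sub_re, one_re, neg_re, mul_re, ofReal_re, ofReal_im, mul_zero, sub_zero]
      gcongr
      nlinarith
    · have h := integrableOn_rpow_mul_exp_neg_mul_rpow (p := 1) (s := a.re - 1) (b := ρ₀.re / 2)
        (by linarith) one_pos (by linarith)
      simpa [IntegrableOn] using h
  have hR : DifferentiableOn ℂ (fun ρ : ℂ => ρ ^ (-a) * Gamma a) {ρ : ℂ | 0 < ρ.re} := by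
    intro ρ hρ
    refine DifferentiableAt.differentiableWithinAt (DifferentiableAt.mul_const ?_ _)
    exact differentiableAt_id.cpow_const (Or.inl hρ)
  have hconn : IsPreconnected {ρ : ℂ | 0 < ρ.re} := (convex_halfSpace_re_gt 0).isPreconnected
  refine (hL.analyticOnNhd hopen).eqOn_of_preconnected_of_frequently_eq (hR.analyticOnNhd hopen)
    hconn (z₀ := 1) (by simp) ?_ hρ
  -- For real `ρ > 0` the formula is the classical one; such points accumulating at `1` suffice for
  -- the identity theorem.
  have hseq : Tendsto (fun n : ℕ => ((1 + 1 / ((n : ℝ) + 1) : ℝ) : ℂ)) atTop (𝓝[≠] 1) := by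
    refine tendsto_nhdsWithin_iff.2 ⟨?_, Eventually.of_forall fun n => ?_⟩
    · have h2 := (continuous_ofReal.tendsto (1 + 0)).comp
        ((tendsto_one_div_add_atTop_nhds_zero_nat (𝕜 := ℝ)).const_add 1)
      simpa [Function.comp_def] using h2
    · simp only [mem_compl_iff, mem_singleton_iff]
      norm_cast
      simp only [add_eq_left, one_div, inv_eq_zero]
      positivity
  refine hseq.frequently (Eventually.frequently (Eventually.of_forall fun n => ?_))
  have hr : (0 : ℝ) < 1 + 1 / ((n : ℝ) + 1) := by positivity
  rw [integral_cpow_mul_exp_neg_mul_Ioi ha hr, one_div, inv_cpow, cpow_neg]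
  rw [arg_ofReal_of_nonneg hr.le]
  exact Real.pi_pos.ne

/-- Source of the exponential gain: a rotation by `ψ` with the sign of `Im a` makes the power decay
in `|Im a|`. -/
theorem norm_exp_mul_I_cpow {ψ : ℝ} (h1 : -Real.pi < ψ) (h2 : ψ ≤ Real.pi) (a : ℂ) :
    ‖exp (ψ * I) ^ a‖ = Real.exp (-(ψ * a.im)) := by
  rw [norm_cpow_of_ne_zero (exp_ne_zero _), norm_exp_ofReal_mul_I, Real.one_rpow, arg_exp_mul_I,
    (toIocMod_eq_self Real.two_pi_pos).2 ⟨h1, by linarith⟩, one_div, Real.exp_neg]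

/-- The sign is `±1` even at `x = 0`, so a tilt multiplied by it keeps its absolute value. -/
theorem exists_sign_mul_eq_abs (x : ℝ) : ∃ ε : ℝ, |ε| = 1 ∧ ε * x = |x| := by
  rcases le_total 0 x with h | h
  · exact ⟨1, by simp, by simp [abs_of_nonneg h]⟩
  · exact ⟨-1, by simp, by simp [abs_of_nonpos h]⟩

/-- Exponential decay of the Gamma function on a vertical strip. -/
theorem exists_norm_Gamma_le {ψ a b : ℝ} (h0 : 0 < ψ) (h1 : ψ < Real.pi / 2) (ha : 0 < a) :
    ∃ C : ℝ, 0 < C ∧ ∀ s : ℂ, a ≤ s.re → s.re ≤ b → ‖Gamma s‖ ≤ C * Real.exp (-(ψ * |s.im|)) := by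
  have hcos : 0 < Real.cos ψ := Real.cos_pos_of_mem_Ioo ⟨by linarith, h1⟩
  obtain ⟨C, hC0, hC⟩ := exists_one_div_rpow_mul_Gamma_le hcos (b := b) ha
  refine ⟨C, hC0, fun s hs1 hs2 => ?_⟩
  obtain ⟨ε, hε, hεs⟩ := exists_sign_mul_eq_abs s.im
  have hs : 0 < s.re := ha.trans_le hs1
  set ρ : ℂ := exp ((ε * ψ : ℝ) * I) with hρ
  have habs : |ε * ψ| = ψ := by rw [abs_mul, hε, one_mul, abs_of_pos h0]
  have hbd := abs_le.1 habs.le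
  have hρre : ρ.re = Real.cos ψ := by rw [hρ, exp_ofReal_mul_I_re, ← Real.cos_abs, habs]
  have hnorm : ‖ρ ^ s‖ = Real.exp (-(ψ * |s.im|)) := by
    rw [hρ, norm_exp_mul_I_cpow (by linarith [Real.pi_pos]) (by linarith [Real.pi_pos]), ← hεs]
    ring_nf
  have hG : Gamma s = ρ ^ s * ∫ t : ℝ in Ioi 0, (t : ℂ) ^ (s - 1) * exp (-(ρ * t)) := by
    rw [integral_cpow_mul_exp_neg_mul_of_re_pos hs (by rw [hρre]; exact hcos), ← mul_assoc,
      ← cpow_add _ _ (exp_ne_zero _)]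
    simp
  rw [hG, norm_mul, hnorm, mul_comm]
  gcongr
  refine (norm_integral_cpow_mul_le (c := 1) hs hcos fun t _ => ?_).trans ?_
  · rw [norm_exp, one_mul]
    simp [hρre]
  · rw [one_mul]
    exact hC _ hs1 hs2

theorem norm_sin_le_exp_abs_im (z : ℂ) : ‖sin z‖ ≤ Real.exp |z.im| := by
  rw [sin, norm_div, norm_mul, norm_I, mul_one]
  have h := norm_sub_le (exp (-z * I)) (exp (z * I))
  have h1 : ‖exp (-z * I)‖ ≤ Real.exp |z.im| := by
    rw [norm_exp]; simpa using le_abs_self z.im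
  have h2 : ‖exp (z * I)‖ ≤ Real.exp |z.im| := by
    rw [norm_exp]; simpa using neg_le_abs z.im
  simp only [norm_ofNat]
  linarith

/-- On `|Re s| ≤ 1/2`, reflection gives `1/Γ(s) = Γ(1-s) sin(πs) / π`, with decay rate `π/2 - η`
against growth rate `π`. The recursion `Γ(s) = (s-1) Γ(s-1)` then moves right at no cost, since `|Im
s| ≥ 1` forces `|s-1| ≥ 1`. -/
theorem exists_norm_Gamma_inv_le_of_one_le_abs_im {η : ℝ} (h0 : 0 < η) (h1 : η < Real.pi / 2)
    (n : ℕ) : ∃ C : ℝ, 0 < C ∧ ∀ s : ℂ, -(1 / 2) ≤ s.re → s.re ≤ 1 / 2 + n → 1 ≤ |s.im| →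
      ‖(Gamma s)⁻¹‖ ≤ C * Real.exp ((Real.pi / 2 + η) * |s.im|) := by
  induction n with
  | zero =>
    obtain ⟨C, hC0, hC⟩ := exists_norm_Gamma_le (ψ := Real.pi / 2 - η) (a := 1 / 2) (b := 3 / 2)
      (by linarith) (by linarith) (by norm_num)
    refine ⟨C / Real.pi, by positivity, fun s hs1 hs2 hs3 => ?_⟩
    simp only [Nat.cast_zero, add_zero] at hs2
    have him : s.im ≠ 0 := fun h => by rw [h, abs_zero] at hs3; linarith
    have hg1 : Gamma s ≠ 0 := Gamma_ne_zero fun m h => him (by rw [h]; simp)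
    have hg2 : Gamma (1 - s) ≠ 0 := Gamma_ne_zero_of_re_pos (by simp; linarith)
    have hrefl := Gamma_mul_Gamma_one_sub s
    have hsin : sin (Real.pi * s) ≠ 0 := fun h => by
      rw [h, div_zero] at hrefl
      exact mul_ne_zero hg1 hg2 hrefl
    have hpi : (Real.pi : ℂ) ≠ 0 := ofReal_ne_zero.2 Real.pi_ne_zero
    have heq : (Gamma s)⁻¹ = Gamma (1 - s) * sin (Real.pi * s) / Real.pi := by
      rw [eq_div_iff hsin] at hrefl
      rw [eq_div_iff hpi, inv_mul_eq_iff_eq_mul₀ hg1, ← mul_assoc]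
      exact hrefl.symm
    have hb1 := hC (1 - s) (by simp; linarith) (by simp; linarith)
    have hb2 := norm_sin_le_exp_abs_im (Real.pi * s)
    simp only [sub_im, one_im, zero_sub, abs_neg] at hb1
    simp only [mul_im, ofReal_re, ofReal_im, zero_mul, add_zero, abs_mul,
      abs_of_pos Real.pi_pos] at hb2
    rw [heq, norm_div, norm_mul, norm_real, Real.norm_of_nonneg Real.pi_pos.le]
    calc _ ≤ C * Real.exp (-((Real.pi / 2 - η) * |s.im|)) * Real.exp (Real.pi * |s.im|)
          / Real.pi := by gcongr
      _ = C / Real.pi * (Real.exp (-((Real.pi / 2 - η) * |s.im|)) *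
          Real.exp (Real.pi * |s.im|)) := by ring
      _ = _ := by rw [← Real.exp_add]; ring_nf
  | succ n ih =>
    obtain ⟨C, hC0, hC⟩ := ih
    refine ⟨C, hC0, fun s hs1 hs2 hs3 => ?_⟩
    rcases le_total s.re (1 / 2) with h | h
    · exact hC s hs1 (h.trans (by linarith [Nat.cast_nonneg (α := ℝ) n])) hs3
    · have hn : 1 ≤ ‖s - 1‖ := by
        refine hs3.trans ?_
        simpa using abs_im_le_norm (s - 1)
      have hne : s - 1 ≠ 0 := norm_pos_iff.1 (by linarith)
      have hrec := Gamma_add_one (s - 1) hne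
      rw [sub_add_cancel] at hrec
      have hih := hC (s - 1) (by simp; linarith) (by simp at hs2 ⊢; linarith) (by simpa using hs3)
      rw [hrec, mul_inv, norm_mul, norm_inv]
      calc _ ≤ 1 * ‖(Gamma (s - 1))⁻¹‖ := by
            gcongr
            exact inv_le_one_of_one_le₀ hn
        _ ≤ _ := by simpa using hih

/-- Growth of the reciprocal Gamma function on a vertical strip. -/
theorem exists_norm_Gamma_inv_le {η : ℝ} (h0 : 0 < η) (h1 : η < Real.pi / 2) (b : ℝ) :
    ∃ C : ℝ, 0 < C ∧ ∀ s : ℂ, -(1 / 2) ≤ s.re → s.re ≤ b →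
      ‖(Gamma s)⁻¹‖ ≤ C * Real.exp ((Real.pi / 2 + η) * |s.im|) := by
  obtain ⟨n, hn⟩ := exists_nat_ge b
  obtain ⟨C, hC0, hC⟩ := exists_norm_Gamma_inv_le_of_one_le_abs_im h0 h1 n
  -- On the remaining rectangle `|Im s| ≤ 1` the entire function `1/Γ` is bounded.
  obtain ⟨D, hD⟩ := ((isCompact_Icc (a := -(1 / 2 : ℝ)) (b := b)).reProdIm
    (isCompact_Icc (a := (-1 : ℝ)) (b := 1))).exists_bound_of_continuousOn
    (f := fun s => (Gamma s)⁻¹) differentiable_one_div_Gamma.continuous.continuousOn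
  refine ⟨C + |D|, by positivity, fun s hs1 hs2 => ?_⟩
  have hpos : 0 ≤ (Real.pi / 2 + η) * |s.im| := by positivity
  rcases le_total 1 |s.im| with h | h
  · refine (hC s hs1 (by linarith) h).trans ?_
    gcongr
    linarith [abs_nonneg D]
  · have := hD s (by
      rw [mem_reProdIm]
      exact ⟨⟨hs1, hs2⟩, abs_le.1 h⟩)
    calc _ ≤ (C + |D|) * 1 := by linarith [le_abs_self D]
      _ ≤ _ := by
        gcongr
        exact Real.one_le_exp hpos

/-! ### The polylogarithm as a tilted integral -/

theorem isOpen_polylogDomain : IsOpen polylogDomain :=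
  (isometry_ofReal.isClosedEmbedding.isClosedMap _ isClosed_Ici).isOpen_compl

theorem segment_zero_subset_polylogDomain {z : ℂ} (hz : z ∈ polylogDomain) :
    segment ℝ 0 z ⊆ polylogDomain := by
  intro w hw
  rw [segment_eq_image] at hw
  obtain ⟨t, ⟨ht0, ht1⟩, rfl⟩ := hw
  rintro ⟨x, hx, h⟩
  have hx1 : (1 : ℝ) ≤ x := hx
  have h' : (x : ℂ) = (t : ℂ) * z := by simpa using h
  rcases ht0.eq_or_lt with ht | ht
  · rw [← ht] at h'
    have hx0 : x = 0 := by simpa using h'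
    linarith
  · have htc : (t : ℂ) ≠ 0 := ofReal_ne_zero.2 ht.ne'
    refine hz ⟨x / t, ?_, ?_⟩
    · rw [mem_Ici, le_div_iff₀ ht]
      linarith
    · simp only [ofReal_div]
      rw [h']
      field_simp

/-- `1 - z * exp (-ρ t)` stays away from zero for `z` in a compact subset of the slit plane and
`ρ` close to `1` on the unit circle. -/
theorem exists_le_norm_one_sub_mul_exp {K : Set ℂ} (hK : IsCompact K) (hKD : K ⊆ polylogDomain) :
    ∃ δ₀ c R : ℝ, 0 < δ₀ ∧ δ₀ < 1 ∧ 0 < c ∧ 0 ≤ R ∧ (∀ z ∈ K, ‖z‖ ≤ R) ∧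
      ∀ δ : ℝ, |δ| ≤ δ₀ → ∀ z ∈ K, ∀ t : ℝ, 0 ≤ t →
        c ≤ ‖1 - z * exp (-(exp (δ * I) * t))‖ := by
  obtain ⟨R', hR'⟩ := hK.exists_bound_of_continuousOn (f := fun z => z) continuousOn_id
  set R := |R'| with hRdef
  have hR0 : 0 ≤ R := abs_nonneg _
  have hR : ∀ z ∈ K, ‖z‖ ≤ R := fun z hz => (hR' z hz).trans (le_abs_self _)
  -- Beyond `T`, `cos δ ≥ 1/2` gives `e^(-t cos δ) ≤ 1 / (2(R+1))`, hence `|z e^(-ρt)| ≤ 1/2`; only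
  -- `t ∈ [0, T]` needs compactness.
  set T := 2 * Real.log (2 * (R + 1)) with hT
  let f : ℝ × ℂ × ℝ → ℂ := fun p => 1 - p.2.1 * exp (-(exp (p.1 * I) * p.2.2))
  have hf : Continuous f := by fun_prop
  have hKT : IsCompact (K ×ˢ Icc 0 T) := hK.prod isCompact_Icc
  have hopen : IsOpen {p | f p ≠ 0} := isOpen_ne_fun hf continuous_const
  -- Without tilt, a zero would mean `z = e^t ∈ [1, ∞)`. The tube lemma then extends nonvanishing to
  -- small `δ`.
  have hsub : ({0} : Set ℝ) ×ˢ (K ×ˢ Icc 0 T) ⊆ {p | f p ≠ 0} := by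
    rintro ⟨δ, z, t⟩ ⟨hδ, hz, ht⟩ h
    rw [mem_singleton_iff] at hδ
    dsimp only at hδ hz ht
    simp only [f, hδ, ofReal_zero, zero_mul, exp_zero, one_mul] at h
    refine hKD hz ⟨Real.exp t, Real.one_le_exp ht.1, ?_⟩
    have h1 : z * exp (-t) = 1 := (sub_eq_zero.1 h).symm
    dsimp only
    rw [ofReal_exp, ← one_mul (exp (t : ℂ)), ← h1, mul_assoc, ← exp_add]
    simp
  obtain ⟨u, v, hu, -, hu0, hv, huv⟩ := generalized_tube_lemma isCompact_singleton hKT hopen hsub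
  obtain ⟨r, hr, hru⟩ := Metric.isOpen_iff.1 hu 0 (hu0 rfl)
  set δ₀ := min (r / 2) (1 / 2) with hδ₀
  have hδ₀r : δ₀ ≤ r / 2 := min_le_left _ _
  have hδ₀1 : δ₀ ≤ 1 / 2 := min_le_right _ _
  have hδ₀0 : 0 < δ₀ := lt_min (by linarith) (by norm_num)
  have hne : ∀ p ∈ Icc (-δ₀) δ₀ ×ˢ (K ×ˢ Icc 0 T), f p ≠ 0 := by
    rintro ⟨δ, p⟩ ⟨hδ, hp⟩
    refine huv ⟨hru ?_, hv hp⟩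
    rw [Metric.mem_ball, dist_zero_right, Real.norm_eq_abs]
    exact (abs_le.2 hδ).trans_lt (by linarith)
  obtain ⟨C, hC⟩ := (isCompact_Icc.prod hKT).exists_bound_of_continuousOn
    (hf.continuousOn.inv₀ hne)
  refine ⟨δ₀, min (1 / 2) (|C| + 1)⁻¹, R, hδ₀0, by linarith, lt_min (by norm_num) (by positivity),
    hR0, hR, fun δ hδ z hz t ht => ?_⟩
  rcases le_total t T with htT | htT
  · have hmem : (δ, z, t) ∈ Icc (-δ₀) δ₀ ×ˢ (K ×ˢ Icc 0 T) := ⟨abs_le.1 hδ, hz, ht, htT⟩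
    have h1 := hC _ hmem
    have h2 : 0 < ‖f (δ, z, t)‖ := norm_pos_iff.2 (hne _ hmem)
    rw [Pi.inv_apply, norm_inv] at h1
    refine (min_le_right _ _).trans ?_
    change _ ≤ ‖f (δ, z, t)‖
    rw [inv_le_comm₀ (by positivity) h2]
    linarith [le_abs_self C]
  · refine (min_le_left _ _).trans ?_
    have hcos : 1 / 2 ≤ Real.cos δ := by
      have h1 := Real.one_sub_sq_div_two_le_cos (x := δ)
      have h2 : δ ^ 2 ≤ (1 / 2) ^ 2 := sq_le_sq' (by linarith [(abs_le.1 hδ).1])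
        (by linarith [(abs_le.1 hδ).2])
      linarith
    have hsmall : ‖z * exp (-(exp (δ * I) * t))‖ ≤ 1 / 2 := by
      rw [norm_mul, norm_exp]
      simp only [neg_re, mul_re, exp_ofReal_mul_I_re, ofReal_re, ofReal_im, mul_zero, sub_zero]
      have h3 : Real.exp (-(Real.cos δ * t)) ≤ (2 * (R + 1))⁻¹ := by
        rw [← Real.exp_log (show 0 < 2 * (R + 1) by linarith), ← Real.exp_neg]
        apply Real.exp_le_exp.2
        nlinarith
      calc _ ≤ (R + 1) * (2 * (R + 1))⁻¹ := by
            gcongr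
            linarith [hR z hz]
        _ = 1 / 2 := by
          have : R + 1 ≠ 0 := by linarith
          field_simp
    have := norm_sub_norm_le (1 : ℂ) (z * exp (-(exp (δ * I) * t)))
    rw [norm_one] at this
    linarith

/-- The integral representation of the polylogarithm along the ray of direction `ρ`. -/
noncomputable def polylogIntegral (ρ α z : ℂ) : ℂ :=
  ρ ^ α * (Gamma α)⁻¹ * ∫ t : ℝ in Ioi 0, (t : ℂ) ^ (α - 1) *
    (z * exp (-(ρ * t)) / (1 - z * exp (-(ρ * t))))

theorem ofReal_mul_cpow {r : ℝ} (hr : 0 < r) {x : ℂ} (hx : x ≠ 0) (a : ℂ) :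
    ((r : ℂ) * x) ^ a = (r : ℂ) ^ a * x ^ a := by
  have hr0 : (r : ℂ) ≠ 0 := ofReal_ne_zero.2 hr.ne'
  rw [cpow_def_of_ne_zero (mul_ne_zero hr0 hx), cpow_def_of_ne_zero hr0, cpow_def_of_ne_zero hx,
    log_ofReal_mul hr hx, add_mul, exp_add, ofReal_log hr.le]

/-- Expanding the geometric series, the `n`-th integral is `z^(n+1) Γ(α) ((n+1)ρ)^(-α)`; the
prefactor cancels `Γ(α)` and `ρ^(-α)`. -/
theorem hasSum_polylogIntegral {ρ α z : ℂ} (hρ : 0 < ρ.re) (hα : 0 < α.re) (hz : ‖z‖ < 1) :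
    HasSum (fun n : ℕ => z ^ (n + 1) / ((n + 1 : ℕ) : ℂ) ^ α) (polylogIntegral ρ α z) := by
  have hρ0 : ρ ≠ 0 := fun h => by simp [h] at hρ
  have hgeo : Summable fun n : ℕ => ‖z‖ ^ (n + 1) :=
    (summable_nat_add_iff 1).2 (summable_geometric_of_lt_one (norm_nonneg z) hz)
  have hnorm : ∀ t : ℝ, ‖exp (-(ρ * t))‖ = Real.exp (-(ρ.re * t)) := fun t => by
    rw [norm_exp]; simp
  have key := hasSum_integral_of_dominated_convergence (μ := volume.restrict (Ioi (0 : ℝ)))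
    (F := fun (n : ℕ) (t : ℝ) => (t : ℂ) ^ (α - 1) * (z * exp (-(ρ * t))) ^ (n + 1))
    (f := fun t => (t : ℂ) ^ (α - 1) * (z * exp (-(ρ * t)) / (1 - z * exp (-(ρ * t)))))
    (fun n t => t ^ (α.re - 1) * Real.exp (-(ρ.re * t)) * ‖z‖ ^ (n + 1)) ?_ ?_ ?_ ?_ ?_
  · have hterm : ∀ n : ℕ, ρ ^ α * (Gamma α)⁻¹ * ∫ t : ℝ in Ioi 0, (t : ℂ) ^ (α - 1) *
        (z * exp (-(ρ * t))) ^ (n + 1) = z ^ (n + 1) / ((n + 1 : ℕ) : ℂ) ^ α := by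
      intro n
      have h1 : ∀ t : ℝ, (t : ℂ) ^ (α - 1) * (z * exp (-(ρ * t))) ^ (n + 1) =
          z ^ (n + 1) * ((t : ℂ) ^ (α - 1) * exp (-((((n + 1 : ℕ) : ℝ) * ρ) * t))) := by
        intro t
        rw [mul_pow, ← exp_nat_mul]
        push_cast
        ring_nf
      have hmul : (((n + 1 : ℕ) : ℝ) * ρ) ^ (-α) = (((n + 1 : ℕ) : ℝ) : ℂ) ^ (-α) * ρ ^ (-α) :=
        ofReal_mul_cpow (by positivity) hρ0 _
      simp_rw [h1]
      rw [integral_const_mul, integral_cpow_mul_exp_neg_mul_of_re_pos hα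
        (by rw [re_ofReal_mul]; positivity), hmul, cpow_neg, cpow_neg]
      have hG : Gamma α ≠ 0 := Gamma_ne_zero_of_re_pos hα
      have hρα : ρ ^ α ≠ 0 := by simp [cpow_eq_zero_iff, hρ0]
      push_cast
      field_simp
    have := key.mul_left (ρ ^ α * (Gamma α)⁻¹)
    simp only [hterm] at this
    exact this
  · intro n
    refine (ContinuousOn.mul (fun t ht => ?_) (by fun_prop)).aestronglyMeasurable measurableSet_Ioi
    exact (continuousAt_ofReal_cpow_const _ _ (Or.inr (ne_of_gt ht))).continuousWithinAt
  · intro n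
    filter_upwards [ae_restrict_mem measurableSet_Ioi] with t ht
    have ht : 0 < t := ht
    rw [norm_mul, norm_cpow_eq_rpow_re_of_pos ht, norm_pow, norm_mul, hnorm, mul_pow, sub_re,
      one_re, mul_assoc, mul_comm (‖z‖ ^ (n + 1))]
    gcongr
    -- One exponential factor is kept for integrability; `‖z‖ ^ (n + 1)` provides summability.
    refine pow_le_of_le_one (by positivity) (Real.exp_le_one_iff.2 ?_) (by simp)
    have := mul_pos hρ ht
    linarith
  · exact Eventually.of_forall fun t => hgeo.mul_left _
  · simp_rw [tsum_mul_left]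
    refine Integrable.mul_const ?_ _
    have h := integrableOn_rpow_mul_exp_neg_mul_rpow (p := 1) (s := α.re - 1) (b := ρ.re)
        (by linarith) one_pos hρ
    simpa [IntegrableOn] using h
  · filter_upwards [ae_restrict_mem measurableSet_Ioi] with t ht
    have ht : 0 < t := ht
    have hlt : ‖z * exp (-(ρ * t))‖ < 1 := by
      rw [norm_mul, hnorm]
      refine mul_lt_one_of_nonneg_of_lt_one_left (norm_nonneg _) hz (Real.exp_le_one_iff.2 ?_)
      have := mul_pos hρ ht
      linarith
    have := ((hasSum_geometric_of_norm_lt_one hlt).mul_left (z * exp (-(ρ * t)))).mul_left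
      ((t : ℂ) ^ (α - 1))
    simpa only [pow_succ', div_eq_mul_inv] using this

theorem norm_mul_exp_div_le {ρ z : ℂ} {c R t : ℝ} (hc : 0 < c) (hR : ‖z‖ ≤ R)
    (hcl : c ≤ ‖1 - z * exp (-(ρ * t))‖) :
    ‖z * exp (-(ρ * t)) / (1 - z * exp (-(ρ * t)))‖ ≤ R / c * Real.exp (-(ρ.re * t)) := by
  have hnorm : ‖exp (-(ρ * t))‖ = Real.exp (-(ρ.re * t)) := by rw [norm_exp]; simp
  rw [norm_div, norm_mul, hnorm, div_mul_eq_mul_div]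
  have := (norm_nonneg z).trans hR
  gcongr

theorem differentiableOn_polylogIntegral {ρ α : ℂ} {V : Set ℂ} {c R : ℝ} (hV : IsOpen V)
    (hρ : 0 < ρ.re) (hα : 0 < α.re) (hc : 0 < c) (hR : ∀ z ∈ V, ‖z‖ ≤ R)
    (hcl : ∀ z ∈ V, ∀ t : ℝ, 0 ≤ t → c ≤ ‖1 - z * exp (-(ρ * t))‖) :
    DifferentiableOn ℂ (polylogIntegral ρ α) V := by
  have hne : ∀ z ∈ V, ∀ t : ℝ, 0 ≤ t → 1 - z * exp (-(ρ * t)) ≠ 0 := fun z hz t ht =>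
    norm_pos_iff.1 (hc.trans_le (hcl z hz t ht))
  refine DifferentiableOn.const_mul (differentiableOn_integral_of_dominated hV
    (g := fun t => t ^ (α.re - 1) * (R / c * Real.exp (-(ρ.re * t)))) ?_ ?_ ?_ ?_) _
  · intro z hz
    refine (ContinuousOn.mul (fun t ht => ?_) (ContinuousOn.div (by fun_prop) (by fun_prop)
      fun t ht => hne z hz t (le_of_lt ht))).aestronglyMeasurable measurableSet_Ioi
    exact (continuousAt_ofReal_cpow_const _ _ (Or.inr (ne_of_gt ht))).continuousWithinAt
  · filter_upwards [ae_restrict_mem measurableSet_Ioi] with t ht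
    exact DifferentiableOn.const_mul (DifferentiableOn.div (by fun_prop) (by fun_prop)
      fun z hz => hne z hz t (le_of_lt ht)) _
  · filter_upwards [ae_restrict_mem measurableSet_Ioi] with t ht z hz
    have ht : 0 < t := ht
    rw [norm_mul, norm_cpow_eq_rpow_re_of_pos ht, sub_re, one_re]
    gcongr
    exact norm_mul_exp_div_le hc (hR z hz) (hcl z hz t ht.le)
  · have h := integrableOn_rpow_mul_exp_neg_mul_rpow (p := 1) (s := α.re - 1) (b := ρ.re)
        (by linarith) one_pos hρ
    have h2 : IntegrableOn (fun t : ℝ => t ^ (α.re - 1) * Real.exp (-(ρ.re * t))) (Ioi 0) := by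
      simpa using h
    refine (Integrable.const_mul h2 (R / c)).congr (Eventually.of_forall fun t => ?_)
    dsimp only
    ring

theorem isPolylog_polylogIntegral {α : ℂ} (hα : 0 < α.re) :
    IsPolylog α (polylogIntegral 1 α) where
  hasSum z hz := hasSum_polylogIntegral (by simp) hα hz
  differentiableOn z hz := by
    obtain ⟨r, hr, hrD⟩ := Metric.isOpen_iff.1 isOpen_polylogDomain z hz
    obtain ⟨δ₀, c, R, hδ0, -, hc, -, hR, h⟩ := exists_le_norm_one_sub_mul_exp
      (isCompact_closedBall z (r / 2))
      ((Metric.closedBall_subset_ball (by linarith)).trans hrD)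
    have hsub := Metric.ball_subset_closedBall (x := z) (ε := r / 2)
    have := differentiableOn_polylogIntegral (ρ := 1) (α := α) (Metric.isOpen_ball (x := z)
      (ε := r / 2)) (by simp) hα hc (fun w hw => hR w (hsub hw))
      (fun w hw t ht => by simpa using h 0 (by simpa using hδ0.le) w (hsub hw) t ht)
    exact (this.differentiableAt (Metric.ball_mem_nhds _ (by linarith))).differentiableWithinAt

/-- The operator `z d/dz` multiplies the coefficient of `z^n` by `n`, lowering the order by one;
this also supplies the continuation for `Re α ≤ 0`. -/
theorem IsPolylog.mul_deriv {α : ℂ} {F : ℂ → ℂ} (hF : IsPolylog α F) :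
    IsPolylog (α - 1) (fun z => z * deriv F z) where
  differentiableOn := differentiableOn_id.mul
    (hF.differentiableOn.deriv isOpen_polylogDomain)
  hasSum z hz := by
    obtain ⟨r, hzr, hr1⟩ := exists_between hz
    have hr0 : 0 ≤ r := (norm_nonneg z).trans hzr.le
    have hsum : Summable fun n : ℕ => ‖(r : ℂ) ^ (n + 1) / ((n + 1 : ℕ) : ℂ) ^ α‖ :=
      (hF.hasSum r (by simpa [abs_of_nonneg hr0] using hr1)).summable.norm
    have h := hasSum_deriv_of_summable_norm (U := Metric.ball (0 : ℂ) r)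
      (F := fun (n : ℕ) (w : ℂ) => w ^ (n + 1) / ((n + 1 : ℕ) : ℂ) ^ α) hsum
      (fun n => by fun_prop) Metric.isOpen_ball ?_ (show z ∈ _ by simpa using hzr)
    · have hd : deriv (fun w : ℂ => ∑' n : ℕ, w ^ (n + 1) / ((n + 1 : ℕ) : ℂ) ^ α) z =
          deriv F z := by
        refine Filter.EventuallyEq.deriv_eq ?_
        filter_upwards [Metric.isOpen_ball.mem_nhds (show z ∈ Metric.ball (0 : ℂ) 1 by simpa)]
          with w hw
        exact (hF.hasSum w (by simpa using hw)).tsum_eq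
      rw [hd] at h
      convert! h.mul_left z using 2 with n
      have hn : ((n + 1 : ℕ) : ℂ) ≠ 0 := Nat.cast_ne_zero.2 n.succ_ne_zero
      have hna : ((n + 1 : ℕ) : ℂ) ^ α ≠ 0 := fun h => hn (cpow_eq_zero_iff _ _ |>.1 h).1
      rw [cpow_sub _ _ hn, cpow_one]
      simp only [deriv_div_const, deriv_pow_field]
      simp only [Nat.add_sub_cancel]
      field_simp
      ring
    · intro n w hw
      have hw : ‖w‖ < r := by simpa using hw
      simp only [norm_div, norm_pow, norm_real, Real.norm_of_nonneg hr0]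
      gcongr

theorem exists_isPolylog (α : ℂ) : ∃ F, IsPolylog α F := by
  have h : ∀ n : ℕ, ∀ α : ℂ, -(n : ℝ) < α.re → ∃ F, IsPolylog α F := by
    intro n
    induction n with
    | zero => exact fun α hα => ⟨_, isPolylog_polylogIntegral (by simpa using hα)⟩
    | succ n ih =>
      intro α hα
      obtain ⟨F, hF⟩ := ih (α + 1) (by push_cast at hα; simp; linarith)
      have := hF.mul_deriv
      rw [add_sub_cancel_right] at this
      exact ⟨_, this⟩
  obtain ⟨n, hn⟩ := exists_nat_gt (-α.re)
  exact h n α (by linarith)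

theorem isPolylog_polylog (α : ℂ) : IsPolylog α (fun z => polylog α z) := by
  have h := exists_isPolylog α
  have : (fun z => polylog α z) = h.choose := by
    funext z
    rw [polylog, dif_pos h]
  rw [this]
  exact h.choose_spec

theorem polylog_eq_mul_deriv (α : ℂ) {z : ℂ} (hz : z ∈ polylogDomain) :
    polylog α z = z * deriv (fun w => polylog (α + 1) w) z := by
  have := (isPolylog_polylog (α + 1)).mul_deriv
  rw [add_sub_cancel_right] at this
  exact (isPolylog_polylog α).eqOn this hz

theorem exists_norm_polylog_le_of_one_le_re {z₀ : ℂ} (hz₀ : z₀ ∈ polylogDomain) (θ : ℝ) :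
    ∃ r ε C : ℝ, 0 < r ∧ 0 < ε ∧ 0 < C ∧ ε < Real.pi / 2 ∧ Metric.ball z₀ r ⊆ polylogDomain ∧
      ∀ z ∈ Metric.ball z₀ r, ∀ α : ℂ, 1 ≤ α.re → α.re ≤ θ →
        ‖polylog α z‖ ≤ C * Real.exp ((Real.pi / 2 - ε) * |α.im|) := by
  have hseg : IsCompact (segment ℝ 0 z₀) := by
    rw [segment_eq_image_lineMap]
    exact isCompact_Icc.image (AffineMap.lineMap_continuous)
  -- A neighbourhood of the whole segment is needed: the tilted integral is identified with `Li_α`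
  -- near `0` and carried to `z` by the identity theorem.
  obtain ⟨r, hr, hrD⟩ := hseg.exists_cthickening_subset_open isOpen_polylogDomain
    (segment_zero_subset_polylogDomain hz₀)
  obtain ⟨δ₀, c, R, hδ0, hδ1, hc, hR0, hR, h⟩ := exists_le_norm_one_sub_mul_exp
    (hseg.cthickening (r := r)) hrD
  set V := Metric.thickening r (segment ℝ 0 z₀) with hV
  have hVsub : V ⊆ Metric.cthickening r (segment ℝ 0 z₀) := Metric.thickening_subset_cthickening _ _
  have hVo : IsOpen V := Metric.isOpen_thickening
  have hVc : IsPreconnected V := ((convex_segment 0 z₀).thickening r).isPreconnected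
  have hsV : segment ℝ 0 z₀ ⊆ V := Metric.self_subset_thickening hr _
  have h0V : (0 : ℂ) ∈ V := hsV (left_mem_segment ℝ 0 z₀)
  have hpi := Real.pi_gt_three
  have hcos : 0 < Real.cos δ₀ := Real.cos_pos_of_mem_Ioo ⟨by linarith, by linarith⟩
  -- Half of the gain `δ₀` pays for the loss in `1/Γ`.
  obtain ⟨C₁, hC₁0, hC₁⟩ := exists_norm_Gamma_inv_le (η := δ₀ / 2) (by linarith) (by linarith) θ
  obtain ⟨C₂, hC₂0, hC₂⟩ := exists_one_div_rpow_mul_Gamma_le hcos (b := θ) one_pos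
  refine ⟨r, δ₀ / 2, C₁ * (R / c * C₂) + 1, hr, by linarith, by positivity, by linarith,
    ?_, fun z hz α hα1 hα2 => ?_⟩
  · exact (Metric.ball_subset_thickening (right_mem_segment ℝ 0 z₀) r).trans (hVsub.trans hrD)
  have hα : 0 < α.re := by linarith
  have hzV : z ∈ V := Metric.ball_subset_thickening (right_mem_segment ℝ 0 z₀) r hz
  obtain ⟨σ, hσ, hσα⟩ := exists_sign_mul_eq_abs α.im
  set ρ : ℂ := exp ((σ * δ₀ : ℝ) * I) with hρ
  have habs : |σ * δ₀| = δ₀ := by rw [abs_mul, hσ, one_mul, abs_of_pos hδ0]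
  have hbd := abs_le.1 habs.le
  have hρre : ρ.re = Real.cos δ₀ := by rw [hρ, exp_ofReal_mul_I_re, ← Real.cos_abs, habs]
  have hρpos : 0 < ρ.re := hρre ▸ hcos
  have hnorm : ‖ρ ^ α‖ = Real.exp (-(δ₀ * |α.im|)) := by
    rw [hρ, norm_exp_mul_I_cpow (by linarith) (by linarith), ← hσα]
    ring_nf
  have hcl : ∀ w ∈ V, ∀ t : ℝ, 0 ≤ t → c ≤ ‖1 - w * exp (-(ρ * t))‖ := fun w hw t ht =>
    h _ habs.le w (hVsub hw) t ht
  have heq : polylog α z = polylogIntegral ρ α z := by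
    refine (((isPolylog_polylog α).differentiableOn.mono (hVsub.trans hrD)).analyticOnNhd
      hVo).eqOn_of_preconnected_of_eventuallyEq ((differentiableOn_polylogIntegral hVo hρpos hα hc
        (fun w hw => hR w (hVsub hw)) hcl).analyticOnNhd hVo) hVc h0V ?_ hzV
    filter_upwards [Metric.ball_mem_nhds (0 : ℂ) one_pos] with w hw
    have hw : ‖w‖ < 1 := by simpa using hw
    exact ((isPolylog_polylog α).hasSum w hw).unique (hasSum_polylogIntegral hρpos hα hw)
  have hint := norm_integral_cpow_mul_le (a := α) (κ := ρ.re) (c := R / c) hα hρpos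
    (φ := fun t => z * exp (-(ρ * t)) / (1 - z * exp (-(ρ * t))))
    (fun t ht => norm_mul_exp_div_le hc (hR z (hVsub hzV)) (hcl z hzV t ht.le))
  rw [hρre] at hint
  have hint2 := hint.trans (mul_le_mul_of_nonneg_left (hC₂ α.re hα1 hα2) (by positivity))
  rw [heq, polylogIntegral, norm_mul, norm_mul, hnorm]
  calc _ ≤ Real.exp (-(δ₀ * |α.im|)) * (C₁ * Real.exp ((Real.pi / 2 + δ₀ / 2) * |α.im|)) *
        (R / c * C₂) := by
        gcongr
        exact hC₁ α (by linarith) hα2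
    _ = C₁ * (R / c * C₂) * (Real.exp (-(δ₀ * |α.im|)) *
        Real.exp ((Real.pi / 2 + δ₀ / 2) * |α.im|)) := by ring
    _ = C₁ * (R / c * C₂) * Real.exp ((Real.pi / 2 - δ₀ / 2) * |α.im|) := by
        rw [← Real.exp_add]; ring_nf
    _ ≤ _ := by gcongr; linarith

/-- Induction on `n` by `Li_α = z · Li_(α+1)'`. Cauchy's estimate needs the previous bound on a
circle about `z`, hence a ball that shrinks at each step; `ε` does not change. -/
theorem exists_norm_polylog_le_locally {z₀ : ℂ} (hz₀ : z₀ ∈ polylogDomain) (n : ℕ) (θ : ℝ) :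
    ∃ r ε C : ℝ, 0 < r ∧ 0 < ε ∧ 0 < C ∧ ε < Real.pi / 2 ∧ Metric.ball z₀ r ⊆ polylogDomain ∧
      ∀ z ∈ Metric.ball z₀ r, ∀ α : ℂ, 1 - n ≤ α.re → α.re ≤ θ →
        ‖polylog α z‖ ≤ C * Real.exp ((Real.pi / 2 - ε) * |α.im|) := by
  induction n generalizing θ with
  | zero => simpa using exists_norm_polylog_le_of_one_le_re hz₀ θ
  | succ n ih =>
    obtain ⟨r, ε, C, hr, hε, hC, hεπ, hsub, h⟩ := ih (θ + 1)
    refine ⟨r / 2, ε, (‖z₀‖ + r) * (C / (r / 4)), by linarith, hε, by positivity, hεπ,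
      (Metric.ball_subset_ball (by linarith)).trans hsub, fun z hz α hα1 hα2 => ?_⟩
    have hball : Metric.closedBall z (r / 4) ⊆ Metric.ball z₀ r := by
      intro w hw
      rw [Metric.mem_closedBall] at hw
      rw [Metric.mem_ball] at hz ⊢
      linarith [dist_triangle w z z₀]
    have hzD : z ∈ polylogDomain := hsub (hball (Metric.mem_closedBall_self (by linarith)))
    have hzn : ‖z‖ ≤ ‖z₀‖ + r := by
      rw [Metric.mem_ball, dist_eq_norm] at hz
      linarith [norm_le_norm_add_norm_sub' z z₀]
    push_cast at hα1
    have hderiv : ‖deriv (fun w => polylog (α + 1) w) z‖ ≤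
        C * Real.exp ((Real.pi / 2 - ε) * |α.im|) / (r / 4) := by
      refine norm_deriv_le_of_forall_mem_sphere_norm_le (by linarith) ?_ fun w hw => ?_
      · refine ((isPolylog_polylog (α + 1)).differentiableOn.mono ?_).diffContOnCl
        rw [closure_ball _ (by linarith)]
        exact hball.trans hsub
      · have := h w (hball (Metric.sphere_subset_closedBall hw)) (α + 1) (by simp; linarith)
          (by simp; linarith)
        simpa using this
    rw [polylog_eq_mul_deriv α hzD, norm_mul]
    calc _ ≤ (‖z₀‖ + r) * (C * Real.exp ((Real.pi / 2 - ε) * |α.im|) / (r / 4)) := by gcongr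
      _ = _ := by ring

/-! ### Sector bounds for the Hurwitz series -/

/-- A shift to the right fixes the imaginary part and increases the modulus, while `|arg w| = arcsin
(|Im w| / |w|)` in the right half-plane. -/
theorem abs_arg_add_ofReal_le {q : ℂ} (hq : 0 < q.re) {x : ℝ} (hx : 0 ≤ x) :
    |arg (q + x)| ≤ |arg q| := by
  have hre : (q + x).re = q.re + x := by simp
  have him : (q + x).im = q.im := by simp
  have hle : ‖q‖ ≤ ‖q + x‖ := by
    refine abs_le_of_sq_le_sq' ?_ (norm_nonneg _) |>.2
    rw [Complex.sq_norm, Complex.sq_norm, normSq_apply, normSq_apply, hre, him]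
    nlinarith
  have hpos : 0 < ‖q‖ := norm_pos_iff.2 fun h => by simp [h] at hq
  have habs : ∀ y : ℝ, |Real.arcsin y| = Real.arcsin |y| := fun y => by
    rcases le_total 0 y with h | h
    · rw [abs_of_nonneg h, abs_of_nonneg (Real.arcsin_nonneg.2 h)]
    · rw [abs_of_nonpos h, abs_of_nonpos (Real.arcsin_nonpos.2 h), Real.arcsin_neg]
  rw [arg_of_re_nonneg (by rw [hre]; linarith), arg_of_re_nonneg hq.le, habs, habs, him, abs_div,
    abs_div, abs_norm, abs_norm]
  exact Real.monotone_arcsin (by gcongr)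

theorem add_ofReal_ne_zero {q : ℂ} (hq : 0 < q.re) {x : ℝ} (hx : 0 ≤ x) : q + x ≠ 0 := fun h => by
  have := congrArg re h
  simp at this
  linarith

theorem norm_cpow_neg_le {q : ℂ} (hq : 0 < q.re) {x : ℝ} (hx : 0 ≤ x) (s : ℂ) :
    ‖(q + x) ^ (-s)‖ ≤ ‖q + x‖ ^ (-s.re) * Real.exp (|arg q| * |s.im|) := by
  rw [norm_cpow_of_ne_zero (add_ofReal_ne_zero hq hx), div_eq_mul_inv, ← Real.exp_neg, neg_re,
    neg_im, mul_neg, neg_neg]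
  refine mul_le_mul_of_nonneg_left (Real.exp_le_exp.2 ?_) (by positivity)
  calc arg (q + x) * s.im ≤ |arg (q + x)| * |s.im| := by rw [← abs_mul]; exact le_abs_self _
    _ ≤ _ := mul_le_mul_of_nonneg_right (abs_arg_add_ofReal_le hq hx) (abs_nonneg _)

theorem summable_add_natCast_rpow {a σ : ℝ} (ha : 0 < a) (hσ : 1 < σ) :
    Summable fun n : ℕ => (a + n) ^ (-σ) := by
  have h := (Real.summable_one_div_nat_add_rpow a σ).2 hσ
  refine h.congr fun n => ?_
  have : 0 < (n : ℝ) + a := by positivity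
  rw [abs_of_pos this, Real.rpow_neg (by linarith), one_div, add_comm]

/-- Domination of the terms of the Hurwitz series on `σ ≤ Re s ≤ θ`. -/
theorem exists_norm_add_natCast_cpow_neg_le {q : ℂ} (hq : 0 < q.re) {σ : ℝ} (hσ : 0 < σ) (θ : ℝ) :
    ∃ C : ℝ, 0 < C ∧ ∀ x : ℝ, 0 ≤ x → ∀ n : ℕ, ∀ s : ℂ, σ ≤ s.re → s.re ≤ θ →
      ‖(q + x + n) ^ (-s)‖ ≤ C * (q.re + n) ^ (-σ) * Real.exp (|arg q| * |s.im|) := by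
  set m := min q.re 1 with hm
  have hm0 : 0 < m := lt_min hq one_pos
  -- The surplus exponent `Re s - σ` lies in `[0, |θ| + σ]`, and `m ≤ 1` bounds its contribution by
  -- the extreme power.
  refine ⟨m ^ (-(|θ| + σ)), by positivity, fun x hx n s hs1 hs2 => ?_⟩
  have hcast : q + x + n = q + ((x + n : ℝ) : ℂ) := by push_cast; ring
  have hn : (0 : ℝ) ≤ n := Nat.cast_nonneg n
  have hre : q.re + n ≤ ‖q + ((x + n : ℝ) : ℂ)‖ := by
    refine le_trans ?_ (re_le_norm _)
    simp
    linarith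
  rw [hcast]
  refine (norm_cpow_neg_le hq (by positivity) s).trans ?_
  gcongr
  calc ‖q + ((x + n : ℝ) : ℂ)‖ ^ (-s.re) ≤ (q.re + n) ^ (-s.re) :=
        Real.rpow_le_rpow_of_nonpos (by positivity) hre (by linarith)
    _ = (q.re + n) ^ (-(s.re - σ)) * (q.re + n) ^ (-σ) := by
        rw [← Real.rpow_add (by positivity)]; ring_nf
    _ ≤ m ^ (-(|θ| + σ)) * (q.re + n) ^ (-σ) := by
        gcongr
        calc (q.re + n) ^ (-(s.re - σ)) ≤ m ^ (-(s.re - σ)) := by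
              refine Real.rpow_le_rpow_of_nonpos hm0 ?_ (by linarith)
              exact (min_le_left _ _).trans (by linarith)
          _ ≤ _ := by
              refine Real.rpow_le_rpow_of_exponent_ge hm0 (min_le_right _ _) ?_
              linarith [le_abs_self θ]

/-! ### Continuation by a Taylor recursion -/

/-- Continuations of `(s - 1) * ζ(s, q)` to increasing half-planes. -/
noncomputable def hurwitzStep : ℕ → ℂ → ℂ → ℂ
  | 0, q, s => (s - 1) * ∑' n : ℕ, (q + n) ^ (-s)
  | k + 1, q, s => q ^ (1 - s) +
      (s - 1) * ∫ u : ℝ in (0)..1, (1 - u) * hurwitzStep k (q + u) (s + 1)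

theorem summable_add_natCast_cpow_neg {q : ℂ} (hq : 0 < q.re) {s : ℂ} (hs : 1 < s.re) :
    Summable fun n : ℕ => (q + n) ^ (-s) := by
  obtain ⟨C, -, hC⟩ := exists_norm_add_natCast_cpow_neg_le hq (σ := s.re) (by linarith) s.re
  refine Summable.of_norm_bounded (((summable_add_natCast_rpow hq hs).mul_left C).mul_right
    (Real.exp (|arg q| * |s.im|))) fun n => ?_
  simpa using hC 0 le_rfl n s le_rfl le_rfl

theorem continuous_tsum_add_natCast_cpow_neg {q : ℂ} (hq : 0 < q.re) {s : ℂ} (hs : 1 < s.re) :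
    Continuous fun x : ℝ => ∑' n : ℕ, (q + (|x| : ℝ) + n) ^ (-s) := by
  obtain ⟨C, -, hC⟩ := exists_norm_add_natCast_cpow_neg_le hq (σ := s.re) (by linarith) s.re
  refine continuous_tsum (fun n => ?_)
    (((summable_add_natCast_rpow hq hs).mul_left C).mul_right _)
    fun n x => hC |x| (abs_nonneg x) n s le_rfl le_rfl
  refine Continuous.cpow (by fun_prop) continuous_const fun x => Or.inl ?_
  simp only [add_re, ofReal_re, natCast_re]
  positivity

/-- Writing `|x|` keeps the parameter in the right half-plane for all real `x`, so continuity is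
global and passes through the integral. -/
theorem continuous_hurwitzStep (k : ℕ) {q : ℂ} (hq : 0 < q.re) {s : ℂ} (hs : 1 - k < s.re) :
    Continuous fun x : ℝ => hurwitzStep k (q + (|x| : ℝ)) s := by
  induction k generalizing s with
  | zero =>
    simp only [hurwitzStep]
    exact (continuous_tsum_add_natCast_cpow_neg hq (by simpa using hs)).const_mul _
  | succ k ih =>
    simp only [hurwitzStep]
    have h1 := ih (s := s + 1) (by push_cast at hs; simp; linarith)
    refine Continuous.add ?_ (Continuous.mul continuous_const ?_)
    · refine Continuous.cpow (by fun_prop) continuous_const fun x => Or.inl ?_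
      simp only [add_re, ofReal_re]
      positivity
    · have h2 : ∀ x : ℝ, ∫ u : ℝ in (0)..1, (1 - u) * hurwitzStep k (q + (|x| : ℝ) + u) (s + 1) =
          ∫ u : ℝ in (0)..1, (1 - u) * hurwitzStep k (q + (|(|x| + |u|)| : ℝ)) (s + 1) := by
        intro x
        refine intervalIntegral.integral_congr fun u hu => ?_
        rw [uIcc_of_le zero_le_one] at hu
        rw [abs_of_nonneg (a := |x| + |u|) (by positivity), abs_of_nonneg hu.1]
        push_cast
        rw [add_assoc]
      simp_rw [h2]
      refine intervalIntegral.continuous_parametric_intervalIntegral_of_continuous' ?_ 0 1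
      have h3 : Continuous fun p : ℝ × ℝ => |p.1| + |p.2| := by fun_prop
      have h4 := h1.comp h3
      simp only [Function.uncurry_def]
      exact Continuous.mul (by fun_prop) h4

/-- Integration by parts: the remainder is `p^(-s)` minus the integral of `(p+u)^(-s)` over `[0,
1]`. -/
theorem intervalIntegral_taylor_cpow {p s : ℂ} (hp : 0 < p.re) (hs : s ≠ 1) :
    ∫ u : ℝ in (0)..1, (1 - u) * (s * (p + u) ^ (-(s + 1))) =
      p ^ (-s) - (p ^ (1 - s) - (p + 1) ^ (1 - s)) / (s - 1) := by
  have hs1 : s - 1 ≠ 0 := sub_ne_zero.2 hs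
  have hslit : ∀ u : ℝ, 0 ≤ u → p + u ∈ slitPlane := fun u hu => Or.inl (by simp; linarith)
  have hd : ∀ u ∈ uIcc (0 : ℝ) 1, HasDerivAt
      (fun u : ℝ => -((1 - u) * (p + u) ^ (-s)) + (p + u) ^ (1 - s) / (s - 1))
      ((1 - u) * (s * (p + u) ^ (-(s + 1)))) u := by
    intro u hu
    rw [uIcc_of_le zero_le_one] at hu
    have h0 : HasDerivAt (fun w : ℂ => p + w) 1 (u : ℂ) := (hasDerivAt_id _).const_add p
    have h1 := h0.cpow_const (c := -s) (hslit u hu.1)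
    have h2 := h0.cpow_const (c := 1 - s) (hslit u hu.1)
    have h3 : HasDerivAt (fun w : ℂ => 1 - w) (-1) (u : ℂ) := (hasDerivAt_id _).const_sub 1
    have h4 := ((h3.mul h1).neg.add (h2.div_const (s - 1))).comp_ofReal
    convert! h4 using 1
    rw [show -s - 1 = -(s + 1) by ring, show 1 - s - 1 = -s by ring]
    field_simp
    ring
  rw [intervalIntegral.integral_eq_sub_of_hasDerivAt hd]
  · simp
    ring
  · refine ContinuousOn.intervalIntegrable ?_
    refine ContinuousOn.mul (by fun_prop) (ContinuousOn.mul (by fun_prop) fun u hu => ?_)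
    rw [uIcc_of_le zero_le_one] at hu
    exact ContinuousWithinAt.cpow (by fun_prop) (by fun_prop) (hslit u hu.1)

theorem tendsto_add_natCast_cpow_zero {q : ℂ} (hq : 0 < q.re) {s : ℂ} (hs : 1 < s.re) :
    Tendsto (fun n : ℕ => (q + n) ^ (1 - s)) atTop (𝓝 0) := by
  have h1 : ∀ n : ℕ, ‖(q + n) ^ (1 - s)‖ ≤
      (q.re + n) ^ (-(s.re - 1)) * Real.exp (|arg q| * |(s - 1).im|) := by
    intro n
    have h := norm_cpow_neg_le hq (Nat.cast_nonneg (α := ℝ) n) (s - 1)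
    rw [neg_sub, ofReal_natCast] at h
    refine h.trans ?_
    gcongr
    refine Real.rpow_le_rpow_of_nonpos (by positivity) ((by simp : _ ≤ (q + n).re).trans
      (re_le_norm _)) (by simp; linarith)
  refine squeeze_zero_norm h1 ?_
  rw [← zero_mul (Real.exp (|arg q| * |(s - 1).im|))]
  exact ((tendsto_rpow_neg_atTop (by linarith)).comp
    (tendsto_atTop_add_const_left _ _ tendsto_natCast_atTop_atTop)).mul_const _

/-- The Taylor formula is summed over `p = q + n`; the differences of `(q+n)^(1-s)` telescope to
`q^(1-s)`. The factor `s` is the `(s+1) - 1` of `hurwitzStep 0` at `s + 1`. -/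
theorem hurwitzStep_one {q : ℂ} (hq : 0 < q.re) {s : ℂ} (hs : 1 < s.re) :
    hurwitzStep 1 q s = hurwitzStep 0 q s := by
  have hs1 : s ≠ 1 := fun h => by simp [h] at hs
  have hs1' : s - 1 ≠ 0 := sub_ne_zero.2 hs1
  obtain ⟨C, hC0, hC⟩ := exists_norm_add_natCast_cpow_neg_le hq (σ := s.re + 1) (by linarith)
    (s.re + 1)
  have hsumB := (((summable_add_natCast_rpow hq (σ := s.re + 1) (by linarith)).mul_left C).mul_right
    (Real.exp (|arg q| * |(s + 1).im|))).mul_left ‖s‖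
  have hint : HasSum
      (fun n : ℕ => ∫ u : ℝ in (0)..1, (1 - u) * (s * (q + n + u) ^ (-(s + 1))))
      (∫ u : ℝ in (0)..1, (1 - u) * hurwitzStep 0 (q + u) (s + 1)) := by
    refine intervalIntegral.hasSum_integral_of_dominated_convergence
      (fun n _ => ‖s‖ * (C * (q.re + n) ^ (-(s.re + 1)) * Real.exp (|arg q| * |(s + 1).im|)))
      (fun n => ?_) (fun n => ?_) (Eventually.of_forall fun u _ => hsumB) (by simp)
      (Eventually.of_forall fun u hu => ?_)
    · refine ContinuousOn.aestronglyMeasurable ?_ measurableSet_uIoc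
      refine ContinuousOn.mul (by fun_prop) (ContinuousOn.mul (by fun_prop) fun u hu => ?_)
      rw [uIoc_of_le zero_le_one] at hu
      refine ContinuousWithinAt.cpow (by fun_prop) (by fun_prop) (Or.inl ?_)
      have := hu.1
      simp only [add_re, ofReal_re, natCast_re]
      positivity
    · refine Eventually.of_forall fun u hu => ?_
      rw [uIoc_of_le zero_le_one] at hu
      have h1 := hC u hu.1.le n (s + 1) (by simp) (by simp)
      have h2 : ‖(1 - u : ℂ)‖ ≤ 1 := by
        rw [← ofReal_one, ← ofReal_sub, norm_real, Real.norm_eq_abs, abs_le]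
        constructor <;> linarith [hu.1, hu.2]
      rw [norm_mul, norm_mul, add_right_comm]
      calc _ ≤ 1 * (‖s‖ * (C * (q.re + n) ^ (-(s.re + 1)) *
            Real.exp (|arg q| * |(s + 1).im|))) := by gcongr
        _ = _ := one_mul _
    · rw [uIoc_of_le zero_le_one] at hu
      have hu0 := hu.1
      have h1 := (summable_add_natCast_cpow_neg (q := q + u) (s := s + 1) (by simp; linarith)
        (by simp; linarith)).hasSum
      have h2 := (h1.mul_left s).mul_left (1 - u : ℂ)
      simp only [hurwitzStep, add_sub_cancel_right]
      simpa only [add_right_comm q (u : ℂ)] using h2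
  have hterm : ∀ n : ℕ, ∫ u : ℝ in (0)..1, (1 - u) * (s * (q + n + u) ^ (-(s + 1))) =
      (q + n) ^ (-s) - ((q + n) ^ (1 - s) - (q + (n + 1 : ℕ)) ^ (1 - s)) / (s - 1) := by
    intro n
    rw [intervalIntegral_taylor_cpow (by simp; positivity) hs1]
    push_cast
    rw [add_assoc]
  simp_rw [hterm] at hint
  have hzeta := (summable_add_natCast_cpow_neg hq hs).hasSum
  have hdiff := (hzeta.sub hint).tendsto_sum_nat
  simp only [sub_sub_cancel] at hdiff
  have htel : Tendsto (fun N : ℕ => ∑ n ∈ Finset.range N,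
      ((q + n) ^ (1 - s) - (q + (n + 1 : ℕ)) ^ (1 - s)) / (s - 1)) atTop
      (𝓝 ((q ^ (1 - s) - 0) / (s - 1))) := by
    simp_rw [← Finset.sum_div, Finset.sum_range_sub' (fun n : ℕ => (q + n) ^ (1 - s))]
    simpa using ((tendsto_add_natCast_cpow_zero hq hs).const_sub (q ^ (1 - s))).div_const (s - 1)
  have heq := tendsto_nhds_unique hdiff htel
  rw [sub_zero, eq_div_iff hs1'] at heq
  have h1 : hurwitzStep 1 q s = q ^ (1 - s) +
      (s - 1) * ∫ u : ℝ in (0)..1, (1 - u) * hurwitzStep 0 (q + u) (s + 1) := rfl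
  have h0 : hurwitzStep 0 q s = (s - 1) * ∑' n : ℕ, (q + n) ^ (-s) := rfl
  rw [h1, h0, ← heq]
  ring

theorem hurwitzStep_succ (k : ℕ) {q : ℂ} (hq : 0 < q.re) {s : ℂ} (hs : 1 - k < s.re) :
    hurwitzStep (k + 1) q s = hurwitzStep k q s := by
  induction k generalizing q s with
  | zero => exact hurwitzStep_one hq (by simpa using hs)
  | succ k ih =>
    rw [hurwitzStep, hurwitzStep]
    congr 2
    refine intervalIntegral.integral_congr fun u hu => ?_
    rw [uIcc_of_le zero_le_one] at hu
    have := hu.1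
    rw [ih (by simp; linarith) (by push_cast at hs; simp; linarith)]

theorem hurwitzStep_eq_of_le {k l : ℕ} (hkl : k ≤ l) {q : ℂ} (hq : 0 < q.re) {s : ℂ}
    (hs : 1 - k < s.re) : hurwitzStep l q s = hurwitzStep k q s := by
  induction l, hkl using Nat.le_induction with
  | base => rfl
  | succ l hl ih =>
    have : (k : ℝ) ≤ l := Nat.cast_le.2 hl
    rw [hurwitzStep_succ l hq (by linarith), ih]

/-- Polynomial growth is absorbed by an arbitrarily small exponential rate. -/
theorem exists_norm_sub_one_le (a b : ℝ) {η : ℝ} (hη : 0 < η) :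
    ∃ C : ℝ, 0 < C ∧ ∀ s : ℂ, a ≤ s.re → s.re ≤ b → ‖s - 1‖ ≤ C * Real.exp (η * |s.im|) := by
  refine ⟨|a| + |b| + 1 + 1 / η, by positivity, fun s hs1 hs2 => ?_⟩
  have h1 := norm_le_abs_re_add_abs_im (s - 1)
  simp only [sub_re, one_re, sub_im, one_im, sub_zero] at h1
  have h2 : |s.re - 1| ≤ |a| + |b| + 1 := by
    rw [abs_le]
    constructor <;> linarith [neg_abs_le a, le_abs_self b, abs_nonneg a, abs_nonneg b]
  have h3 := Real.add_one_le_exp (η * |s.im|)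
  have h4 : 1 ≤ Real.exp (η * |s.im|) := Real.one_le_exp (by positivity)
  have h5 : |s.im| = 1 / η * (η * |s.im|) := by field_simp
  calc ‖s - 1‖ ≤ (|a| + |b| + 1) * 1 + 1 / η * (η * |s.im|) := by linarith
    _ ≤ (|a| + |b| + 1) * Real.exp (η * |s.im|) + 1 / η * Real.exp (η * |s.im|) := by
      gcongr
      linarith
    _ = _ := by ring

theorem exists_norm_cpow_one_sub_le {q : ℂ} (hq : 0 < q.re) (M a b : ℝ) :
    ∃ C : ℝ, 0 < C ∧ ∀ x : ℝ, 0 ≤ x → x ≤ M → ∀ s : ℂ, a ≤ s.re → s.re ≤ b →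
      ‖(q + x) ^ (1 - s)‖ ≤ C * Real.exp (|arg q| * |s.im|) := by
  obtain ⟨C, hC⟩ := (isCompact_Icc (a := (0 : ℝ)) (b := M)).prod
    (isCompact_Icc (a := a) (b := b)) |>.exists_bound_of_continuousOn
    (f := fun p : ℝ × ℝ => ‖q + (p.1 : ℂ)‖ ^ (1 - p.2)) (by
      refine ContinuousOn.rpow (by fun_prop) (by fun_prop) fun p hp => Or.inl ?_
      exact norm_ne_zero_iff.2 (add_ofReal_ne_zero hq hp.1.1))
  refine ⟨|C| + 1, by positivity, fun x hx1 hx2 s hs1 hs2 => ?_⟩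
  have h1 := norm_cpow_neg_le hq hx1 (s - 1)
  simp only [neg_sub, sub_re, one_re, sub_im, one_im, sub_zero] at h1
  refine h1.trans ?_
  gcongr
  have := (le_abs_self _).trans (hC (x, s.re) ⟨⟨hx1, hx2⟩, hs1, hs2⟩)
  dsimp only at this
  linarith [le_abs_self C]

/-! ### Growth on vertical strips and holomorphy -/

/-- Growth of `(s - 1) * ζ(s, q)` on vertical strips, locally uniformly in translates of `q`. -/
theorem exists_norm_hurwitzStep_le (k : ℕ) {q : ℂ} (hq : 0 < q.re) {ψ : ℝ} (hψ : |arg q| < ψ)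
    (M θ : ℝ) : ∃ C : ℝ, 0 < C ∧ ∀ x : ℝ, 0 ≤ x → x ≤ M → ∀ s : ℂ, 2 - k ≤ s.re → s.re ≤ θ →
      ‖hurwitzStep k (q + x) s‖ ≤ C * Real.exp (ψ * |s.im|) := by
  induction k generalizing ψ M θ with
  | zero =>
    obtain ⟨C₁, hC₁0, hC₁⟩ := exists_norm_add_natCast_cpow_neg_le hq (σ := 2) (by norm_num) θ
    obtain ⟨C₂, hC₂0, hC₂⟩ := exists_norm_sub_one_le 2 θ (sub_pos.2 hψ)
    have hsum := summable_add_natCast_rpow hq (σ := 2) (by norm_num)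
    set S := ∑' n : ℕ, (q.re + n) ^ (-2 : ℝ) with hS
    have hS0 : 0 ≤ S := tsum_nonneg fun n => by positivity
    refine ⟨C₂ * (C₁ * S) + 1, by positivity, fun x hx1 _ s hs1 hs2 => ?_⟩
    simp only [Nat.cast_zero, sub_zero] at hs1
    have hb : ‖∑' n : ℕ, (q + x + n) ^ (-s)‖ ≤ C₁ * S * Real.exp (|arg q| * |s.im|) :=
      tsum_of_norm_bounded ((hsum.hasSum.mul_left C₁).mul_right _)
        fun n => hC₁ x hx1 n s hs1 hs2
    rw [hurwitzStep, norm_mul]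
    calc _ ≤ (C₂ * Real.exp ((ψ - |arg q|) * |s.im|)) *
          (C₁ * S * Real.exp (|arg q| * |s.im|)) := by
          gcongr
          exact hC₂ s hs1 hs2
      _ = C₂ * (C₁ * S) * (Real.exp ((ψ - |arg q|) * |s.im|) * Real.exp (|arg q| * |s.im|)) := by
          ring
      _ = C₂ * (C₁ * S) * Real.exp (ψ * |s.im|) := by rw [← Real.exp_add]; ring_nf
      _ ≤ _ := by gcongr; linarith
  | succ k ih =>
    -- The integral grows at rate `φ`, leaving `ψ - φ` for the factor `s - 1`. The recursion
    -- evaluates at `x + u ≤ M + 1` and `s + 1`.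
    obtain ⟨φ, hφ1, hφ2⟩ := exists_between hψ
    obtain ⟨C₁, hC₁0, hC₁⟩ := ih hφ1 (M + 1) (θ + 1)
    obtain ⟨C₂, hC₂0, hC₂⟩ := exists_norm_sub_one_le (2 - (k + 1 : ℕ)) θ (sub_pos.2 hφ2)
    obtain ⟨C₃, hC₃0, hC₃⟩ := exists_norm_cpow_one_sub_le hq M (2 - (k + 1 : ℕ)) θ
    refine ⟨C₃ + C₂ * C₁, by positivity, fun x hx1 hx2 s hs1 hs2 => ?_⟩
    have hb : ‖∫ u : ℝ in (0)..1, (1 - u) * hurwitzStep k (q + x + u) (s + 1)‖ ≤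
        C₁ * Real.exp (φ * |s.im|) := by
      have := intervalIntegral.norm_integral_le_of_norm_le_const (a := (0 : ℝ)) (b := 1)
        (C := C₁ * Real.exp (φ * |s.im|))
        (f := fun u : ℝ => (1 - u) * hurwitzStep k (q + x + u) (s + 1)) fun u hu => ?_
      · simpa using this
      · rw [uIoc_of_le zero_le_one] at hu
        have h2 : ‖(1 - u : ℂ)‖ ≤ 1 := by
          rw [← ofReal_one, ← ofReal_sub, norm_real, Real.norm_eq_abs, abs_le]
          constructor <;> linarith [hu.1, hu.2]
        have h1 := hC₁ (x + u) (by linarith [hu.1]) (by linarith [hu.2]) (s + 1)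
          (by push_cast at hs1; simp; linarith) (by simp; linarith)
        simp only [add_im, one_im, add_zero, ofReal_add, ← add_assoc] at h1
        rw [norm_mul]
        calc _ ≤ 1 * (C₁ * Real.exp (φ * |s.im|)) := by gcongr
          _ = _ := one_mul _
    rw [hurwitzStep]
    refine (norm_add_le _ _).trans ?_
    rw [add_mul, norm_mul]
    refine add_le_add ((hC₃ x hx1 hx2 s hs1 hs2).trans (by gcongr)) ?_
    calc _ ≤ (C₂ * Real.exp ((ψ - φ) * |s.im|)) * (C₁ * Real.exp (φ * |s.im|)) := by
          gcongr
          exact hC₂ s hs1 hs2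
      _ = C₂ * C₁ * (Real.exp ((ψ - φ) * |s.im|) * Real.exp (φ * |s.im|)) := by ring
      _ = _ := by rw [← Real.exp_add]; ring_nf

theorem isOpen_re_im_window (a : ℝ) (s₀ : ℂ) :
    IsOpen {s : ℂ | a < s.re ∧ s.re < s₀.re + 1 ∧ |s.im| < |s₀.im| + 1} :=
  (isOpen_lt continuous_const continuous_re).inter
    ((isOpen_lt continuous_re continuous_const).inter
    (isOpen_lt continuous_im.abs continuous_const))

/-- The growth bound serves as the majorant for differentiating under the integral; on a bounded
window in `s` it is constant. -/
theorem differentiableOn_hurwitzStep (k : ℕ) {q : ℂ} (hq : 0 < q.re) :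
    DifferentiableOn ℂ (hurwitzStep k q) {s : ℂ | 2 - k < s.re} := by
  induction k generalizing q with
  | zero =>
    intro s₀ hs₀
    replace hs₀ : 2 < s₀.re := by simpa using! hs₀
    have ho := isOpen_re_im_window 2 s₀
    obtain ⟨C, hC0, hC⟩ := exists_norm_add_natCast_cpow_neg_le hq (σ := 2) (by norm_num)
      (s₀.re + 1)
    have h := differentiableOn_tsum_of_summable_norm (F := fun (n : ℕ) (s : ℂ) => (q + n) ^ (-s))
      (((summable_add_natCast_rpow hq (σ := 2) (by norm_num)).mul_left C).mul_right
        (Real.exp (|arg q| * (|s₀.im| + 1)))) (fun n => ?_) ho fun n s hs => ?_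
    · have hd := h.differentiableAt (ho.mem_nhds ⟨hs₀, by linarith, by linarith⟩)
      have hf : hurwitzStep 0 q = fun s => (s - 1) * ∑' n : ℕ, (q + n) ^ (-s) := rfl
      rw [hf]
      exact ((differentiableAt_id.sub_const 1).mul hd).differentiableWithinAt
    · refine DifferentiableOn.const_cpow (by fun_prop) (Or.inl ?_)
      exact_mod_cast add_ofReal_ne_zero hq (Nat.cast_nonneg (α := ℝ) n)
    · have h1 := hC 0 le_rfl n s hs.1.le hs.2.1.le
      rw [ofReal_zero, add_zero] at h1
      refine h1.trans ?_
      have := hs.2.2.le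
      gcongr
  | succ k ih =>
    intro s₀ hs₀
    replace hs₀ : 1 - k < s₀.re := by
      have : 2 - ((k + 1 : ℕ) : ℝ) < s₀.re := hs₀
      push_cast at this
      linarith
    have hq0 : q ≠ 0 := by simpa using add_ofReal_ne_zero hq le_rfl
    have ho := isOpen_re_im_window (1 - k) s₀
    obtain ⟨C, hC0, hC⟩ := exists_norm_hurwitzStep_le k hq (lt_add_one |arg q|) 1 (s₀.re + 2)
    have h := differentiableOn_integral_of_dominated (μ := volume.restrict (Ioc (0 : ℝ) 1)) ho
      (f := fun s u => (1 - u) * hurwitzStep k (q + u) (s + 1))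
      (g := fun _ => C * Real.exp ((|arg q| + 1) * (|s₀.im| + 1))) (fun s hs => ?_) ?_ ?_
      (integrable_const _)
    · have hd := h.differentiableAt (ho.mem_nhds ⟨hs₀, by linarith, by linarith⟩)
      have hf : hurwitzStep (k + 1) q = fun s => q ^ (1 - s) + (s - 1) *
          ∫ u : ℝ in Ioc 0 1, (1 - u) * hurwitzStep k (q + u) (s + 1) := by
        funext s
        rw [hurwitzStep, intervalIntegral.integral_of_le zero_le_one]
      rw [hf]
      refine DifferentiableAt.differentiableWithinAt (DifferentiableAt.add ?_
        ((differentiableAt_id.sub_const 1).mul hd))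
      exact DifferentiableAt.const_cpow (by fun_prop) (Or.inl hq0)
    · have hc := continuous_hurwitzStep k hq (s := s + 1) (by simp; linarith [hs.1])
      have hc' : Continuous fun u : ℝ => (1 - u : ℂ) * hurwitzStep k (q + (|u| : ℝ)) (s + 1) := by
        fun_prop
      refine hc'.aestronglyMeasurable.congr ?_
      filter_upwards [ae_restrict_mem measurableSet_Ioc] with u hu
      rw [abs_of_pos hu.1]
    · filter_upwards [ae_restrict_mem measurableSet_Ioc] with u hu
      refine DifferentiableOn.const_mul (DifferentiableOn.comp (ih (q := q + u) (by
        simp; linarith [hu.1])) (by fun_prop) fun s hs => ?_) _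
      show 2 - (k : ℝ) < (s + 1).re
      simp
      linarith [hs.1]
    · filter_upwards [ae_restrict_mem measurableSet_Ioc] with u hu s hs
      have h1 := hC u hu.1.le hu.2 (s + 1) (by simp; linarith [hs.1]) (by simp; linarith [hs.2.1])
      simp only [add_im, one_im, add_zero] at h1
      have h2 : ‖(1 - u : ℂ)‖ ≤ 1 := by
        rw [← ofReal_one, ← ofReal_sub, norm_real, Real.norm_eq_abs, abs_le]
        constructor <;> linarith [hu.1, hu.2]
      have h3 := hs.2.2.le
      rw [norm_mul]
      calc _ ≤ 1 * (C * Real.exp ((|arg q| + 1) * |s.im|)) := by gcongr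
        _ ≤ _ := by rw [one_mul]; gcongr

/-- The entire function `(s - 1) * ζ(s, q)`. -/
noncomputable def hurwitzEntire (q s : ℂ) : ℂ := hurwitzStep ⌈3 - s.re⌉₊ q s

theorem hurwitzEntire_eq {k : ℕ} {q : ℂ} (hq : 0 < q.re) {s : ℂ} (hs : 1 - k < s.re) :
    hurwitzEntire q s = hurwitzStep k q s := by
  have h := Nat.le_ceil (3 - s.re)
  -- Both indices are compared with their maximum.
  rw [hurwitzEntire, ← hurwitzStep_eq_of_le (le_max_left _ k) hq (by linarith),
    hurwitzStep_eq_of_le (le_max_right _ k) hq hs]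

theorem differentiable_hurwitzEntire {q : ℂ} (hq : 0 < q.re) :
    Differentiable ℂ (hurwitzEntire q) := by
  intro s₀
  obtain ⟨k, hk⟩ := exists_nat_gt (2 - s₀.re)
  have ho : IsOpen {s : ℂ | 2 - (k : ℝ) < s.re} := isOpen_lt continuous_const continuous_re
  have hmem : {s : ℂ | 2 - (k : ℝ) < s.re} ∈ 𝓝 s₀ :=
    ho.mem_nhds (show 2 - (k : ℝ) < s₀.re by linarith)
  refine ((differentiableOn_hurwitzStep k hq).differentiableAt hmem).congr_of_eventuallyEq ?_
  filter_upwards [hmem] with s (hs : 2 - (k : ℝ) < s.re)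
  exact hurwitzEntire_eq hq (by linarith)

theorem isHurwitzZeta_hurwitzEntire {q : ℂ} (hq : 0 < q.re) :
    IsHurwitzZeta q (fun s => hurwitzEntire q s / (s - 1)) where
  differentiableOn := (differentiable_hurwitzEntire hq).differentiableOn.div (by fun_prop)
    fun s hs => sub_ne_zero.2 hs
  hasSum s hs := by
    have hs1 : s - 1 ≠ 0 := sub_ne_zero.2 fun h => by simp [h] at hs
    have h0 : hurwitzEntire q s = (s - 1) * ∑' n : ℕ, (q + n) ^ (-s) :=
      hurwitzEntire_eq (k := 0) hq (by simpa using hs)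
    have h := (summable_add_natCast_cpow_neg hq hs).hasSum
    rw [h0, mul_div_cancel_left₀ _ hs1]
    simpa only [cpow_neg, one_div] using h

theorem isHurwitzZeta_complexHurwitzZeta {q : ℂ} (hq : 0 < q.re) :
    IsHurwitzZeta q (fun s => complexHurwitzZeta q s) := by
  have h : ∃ F, IsHurwitzZeta q F := ⟨_, isHurwitzZeta_hurwitzEntire hq⟩
  have : (fun s => complexHurwitzZeta q s) = h.choose := by
    funext s
    rw [complexHurwitzZeta, dif_pos h]
  rw [this]
  exact h.choose_spec

theorem exists_norm_complexHurwitzZeta_le {q : ℂ} (hq : 0 < q.re) {ψ : ℝ} (hψ : |arg q| < ψ)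
    (a b : ℝ) : ∃ C : ℝ, ∀ s : ℂ, a ≤ s.re → s.re ≤ b → 1 ≤ |s.im| →
      ‖complexHurwitzZeta q s‖ ≤ C * Real.exp (ψ * |s.im|) := by
  obtain ⟨k, hk⟩ := exists_nat_gt (2 - a)
  obtain ⟨C, hC0, hC⟩ := exists_norm_hurwitzStep_le k hq hψ 0 b
  refine ⟨C, fun s hs1 hs2 hs3 => ?_⟩
  -- Away from the pole, dividing by `s - 1` loses nothing.
  have hn : 1 ≤ ‖s - 1‖ := hs3.trans (by simpa using abs_im_le_norm (s - 1))
  have hne : s ≠ 1 := fun h => by norm_num [h] at hn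
  have heq : complexHurwitzZeta q s = hurwitzEntire q s / (s - 1) :=
    (isHurwitzZeta_complexHurwitzZeta hq).eqOn (isHurwitzZeta_hurwitzEntire hq) hne
  rw [heq, norm_div, hurwitzEntire_eq (k := k) hq (by linarith)]
  refine (div_le_self (norm_nonneg _) hn).trans ?_
  simpa using hC 0 le_rfl le_rfl s (by linarith) hs2

/-! ### The two estimates -/

theorem proposition3 :
    (∀ q : ℂ, 0 < q.re →
      IsHurwitzZeta q (fun s => complexHurwitzZeta q s) ∧
      ∀ θ₁ θ₂ : ℝ, 0 < θ₁ → 0 < θ₂ →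
        ∃ ε : ℝ, 0 < ε ∧ ∃ C T : ℝ, ∀ s : ℂ, -θ₁ ≤ s.re → s.re ≤ θ₂ → T ≤ |s.im| →
          ‖complexHurwitzZeta q s‖ ≤ C * Real.exp ((Real.pi / 2 - ε) * |s.im|)) ∧
    (∀ α : ℂ, IsPolylog α (fun z => polylog α z)) ∧
    (∀ z : ℂ, z ∈ polylogDomain →
      ∀ θ₁ θ₂ : ℝ, 0 < θ₁ → 0 < θ₂ →
        ∃ ε : ℝ, 0 < ε ∧ ∃ C : ℝ, ∀ α : ℂ, -θ₁ ≤ α.re → α.re ≤ θ₂ →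
          ‖polylog α z‖ ≤ C * Real.exp ((Real.pi / 2 - ε) * |α.im|)) := by
  refine ⟨fun q hq => ⟨isHurwitzZeta_complexHurwitzZeta hq, fun θ₁ θ₂ _ _ => ?_⟩,
    isPolylog_polylog, fun z hz θ₁ θ₂ _ _ => ?_⟩
  -- Any `ψ` between `|arg q|` and `π/2` works, with `ε = π/2 - ψ`.
  · obtain ⟨ψ, hψ1, hψ2⟩ := exists_between (abs_arg_lt_pi_div_two_iff.2 (Or.inl hq))
    obtain ⟨C, hC⟩ := exists_norm_complexHurwitzZeta_le hq hψ1 (-θ₁) θ₂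
    refine ⟨Real.pi / 2 - ψ, by linarith, C, 1, fun s hs1 hs2 hs3 => ?_⟩
    rw [sub_sub_cancel]
    exact hC s hs1 hs2 hs3
  -- This many derivative steps reach `1 - n < -θ₁`.
  · obtain ⟨n, hn⟩ := exists_nat_gt (1 + θ₁)
    obtain ⟨r, ε, C, hr, hε, -, -, -, h⟩ := exists_norm_polylog_le_locally hz n θ₂
    exact ⟨ε, hε, C, fun α hα1 hα2 => h z (Metric.mem_ball_self hr) α (by linarith) hα2⟩
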